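/- Let $\mathcal S$ be a compact metric space, $(\Omega,\mathcal F,\mathbb P)$ a probability space, and for $B\subseteq\Omega$ let $\mathbb P^*[B]=\inf\{\mathbb P[A]:A\supseteq B,\ A\in\mathcal F\}$ and $\mathbb P_*[B]=1-\mathbb P^*[\Omega\setminus B]$ be its outer and inner probability. Let $\ell^\infty(\mathcal S)$ be the space of bounded real functions on $\mathcal S$ with the supremum norm. Let $m\ge 1$, $\mathcal M=\{1,\dots,m\}$, let $\gamma^i\in C(\mathcal S,\mathbb R)$ for $i\in\mathcal M$, let $\hat\gamma^i_n:\Omega\to\ell^\infty(\mathcal S)$ be arbitrary (not necessarily measurable) maps, and let $\tau_n>0$ with $\tau_n\to0$. Assume that, jointly in $i\in\mathcal M$, $$\hat J^i_n:=\tau_n^{-1}(\hat\gamma^i_n-\gamma^i)\ \xrightarrow{d}\ J^i$$ weakly in $\ell^\infty(\mathcal S)^m$ in the sense of Hoffmann-Jørgensen (that is, $\mathbb E^*f(\hat{\mathbf J}_n)\to\mathbb E f(\mathbf J)$ for every bounded continuous $f:\ell^\infty(\mathcal S)^m\to\mathbb R$, where $\mathbb E^*$ is outer expectation), where $\mathbf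 J=(J^1,\dots,J^m):\Omega\to C(\mathcal S,\mathbb R)^m$ is Borel measurable. Put $\mu(s)=\min_{i\in\mathcal M}\gamma^i(s)$. For $\sigma\in\mathcal I:=\{\sigma:\sigma\subseteq\mathcal M\}$ let $$V_\sigma=\{s\in\mathcal S:\ \mu(s)=\gamma^j(s)\text{ if and only if }j\in\sigma\},\qquad G^\sigma=\min_{i\in\sigma}J^i,$$ $$\mathfrak u^+_\sigma(0)=\bigcap_{\eta>0}\overline{\overline{\mu^{-1}([0,\eta])}\cap V_\sigma},\qquad \mathfrak u^-_\sigma(0)=\bigcap_{\eta>0}\overline{\overline{\mu^{-1}([-\eta,0])}\cap V_\sigma}.$$ A supremum over the empty set is $-\infty$; since $V_\emptyset=\emptyset$, the index $\sigma=\emptyset$ contributes $-\infty$ to every maximum below. For $q\in\mathbb R$ let $$\mathcal L=\{s:\mu(s)<0\},\quad \mathcal U=\{s:\mu(s)>0\},\quad \hat{\mathcal L}=\{s:\tau_n^{-1}\min_{i\in\mathcal M}\hat\gamma^i_n(s)<-q\},\quad \hat{\mathcal U}=\{s:\tau_n^{-1}\min_{i\in\mathcal M}\hat\gamma^i_n(s)>q\}.$$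 Then, for every $q\in\mathbb R$, $$\text{(i)}\quad \liminf_{n\to\infty}\mathbb P_*\big[\hat{\mathcal L}\subseteq\mathcal L\ \wedge\ \hat{\mathcal U}\subseteq\mathcal U\big]\ \ge\ \mathbb P\Big[\max_{\sigma\in\mathcal I}\max\Big(\sup_{s\in\mathfrak u^+_\sigma(0)}-G^\sigma(s),\ \sup_{s\in\mathfrak u^-_\sigma(0)}G^\sigma(s)\Big)<q\Big],$$ $$\text{(ii)}\quad \limsup_{n\to\infty}\mathbb P^*\big[\hat{\mathcal L}\subseteq\mathcal L\ \wedge\ \hat{\mathcal U}\subseteq\mathcal U\big]\ \le\ \mathbb P\Big[\max_{\sigma\in\mathcal I}\ \sup_{s\in\mu^{-1}(0)\cap V_\sigma}|G^\sigma(s)|\le q\Big].$$ -/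

import Mathlib

open Set Filter Topology MeasureTheory
open scoped ENNReal BoundedContinuousFunction

namespace ConjunctionCR

noncomputable section

/-- `ℓ^∞(S)`: bounded (not necessarily continuous) functions on `S`, with the supremum norm. -/
abbrev EllInfty (S : Type*) : Type _ := lp (fun _ : S => ℝ) ∞

/-- The inclusion of `C(S, ℝ)` into `ℓ^∞(S)` for compact `S`. -/
def toEllInfty {S : Type*} [TopologicalSpace S] [CompactSpace S] (f : C(S, ℝ)) : EllInfty S :=
  ⟨fun s => f s, memℓp_infty ⟨‖f‖, by
    rintro _ ⟨s, rfl⟩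
    exact f.norm_coe_le_norm s⟩⟩

/-- Outer probability `P^*[B]` of an arbitrary set `B`. -/
def outerProb {Ω : Type*} [MeasurableSpace Ω] (P : Measure Ω) (B : Set Ω) : ℝ≥0∞ :=
  ⨅ (A : Set Ω) (_ : B ⊆ A) (_ : MeasurableSet A), P A

/-- Inner probability `P_*[B] = 1 - P^*[Ω \ B]` of an arbitrary set `B`. -/
def innerProb {Ω : Type*} [MeasurableSpace Ω] (P : Measure Ω) (B : Set Ω) : ℝ≥0∞ :=
  1 - outerProb P Bᶜ

/-- Outer expectation `E^* T = inf {E U : U ≥ T, U measurable, E U exists}`. It is only used for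
bounded `T`, where the infimum is over a nonempty set of reals that is bounded below. -/
def outerExpectation {Ω : Type*} [MeasurableSpace Ω] (P : Measure Ω) (T : Ω → ℝ) : ℝ :=
  sInf {r : ℝ | ∃ U : Ω → ℝ, Measurable U ∧ Integrable U P ∧ (∀ ω, T ω ≤ U ω) ∧ ∫ ω, U ω ∂P = r}

/-- Weak convergence (in the sense of Hoffmann-Jorgensen) of arbitrary, possibly non-measurable,
maps `X n : Ω → D` to a Borel measurable map `Y : Ω → D`. -/
structure ConvergesWeakly {Ω D : Type*} [MeasurableSpace Ω] [TopologicalSpace D]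
    (P : Measure Ω) (X : ℕ → Ω → D) (Y : Ω → D) : Prop where
  borel_measurable : Measurable[_, borel D] Y
  tendsto_outerExpectation : ∀ f : D →ᵇ ℝ,
    Tendsto (fun n => outerExpectation P (fun ω => f (X n ω))) atTop (𝓝 (∫ ω, f (Y ω) ∂P))

/-- `g^σ(s) = min_{j ∈ σ} g^j(s)`, meaningful for nonempty `σ` (a finite infimum of reals). -/
def minOver {m : ℕ} {S : Type*} (g : Fin m → S → ℝ) (σ : Finset (Fin m)) (s : S) : ℝ :=
  ⨅ j : σ, g j s

/-- `V_σ`: the points where the minimum of all the `g^j` is attained exactly by the `j ∈ σ`.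
For `m ≥ 1` the set belonging to `σ = ∅` is empty. -/
def minRegion {m : ℕ} {S : Type*} (g : Fin m → S → ℝ) (σ : Finset (Fin m)) : Set S :=
  {s | ∀ j, minOver g Finset.univ s = g j s ↔ j ∈ σ}

/-- `𝔲⁺(0)` for the target function `μ` and the partition element `V`. -/
def uPlus {S : Type*} [TopologicalSpace S] (μ : S → ℝ) (V : Set S) : Set S :=
  ⋂ (η : ℝ) (_ : 0 < η), closure (closure (μ ⁻¹' Icc 0 η) ∩ V)

/-- `𝔲⁻(0)` for the target function `μ` and the partition element `V`. -/
def uMinus {S : Type*} [TopologicalSpace S] (μ : S → ℝ) (V : Set S) : Set S :=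
  ⋂ (η : ℝ) (_ : 0 < η), closure (closure (μ ⁻¹' Icc (-η) 0) ∩ V)

/-- The event that the estimated regions `{τ⁻¹ ν̂ < -q}` and `{τ⁻¹ ν̂ > q}` are contained in the
true regions `{μ < 0}` and `{μ > 0}`. -/
def inclusionEvent {Ω S : Type*} (τ q : ℝ) (νhat : Ω → S → ℝ) (μ : S → ℝ) : Set Ω :=
  {ω | {s | τ⁻¹ * νhat ω s < -q} ⊆ {s | μ s < 0} ∧ {s | τ⁻¹ * νhat ω s > q} ⊆ {s | μ s > 0}}

end

end ConjunctionCR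

open ConjunctionCR

/-! Both inclusions depend on the estimators only through the fluctuation `y = τ⁻¹ (γ̂ - γ)`, since
`τ⁻¹ γ̂ⁱ = τ⁻¹ γⁱ + yⁱ`. Fix a limit path `x = J ω`. As `n → ∞`, `y → x` uniformly and `s → s₀`, the
`i`-th term tends to `±∞` when `γⁱ(s₀) ≠ 0`, while `yⁱ(s) → xⁱ(s₀)` by continuity of `x`. Only zeros
of `μ` are therefore critical, and there the active indices decide. Compactness of `S` makes the
bounds uniform in `s` (`eventually_forall_scaledMin_bounds`); a single bad point refutes the
inclusions (`eventually_lt_abs_scaledMin`).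

These pathwise statements become probability bounds by `ConvergesWeakly.exists_limsup_outerProb_le`:
(i) bounds the failure of the inclusions, (ii) the inclusions themselves. -/

namespace ConjunctionCR

/-! ### Outer probability and outer expectation. -/

section OuterProbability

variable {Ω : Type*} [MeasurableSpace Ω] {P : Measure Ω}

theorem outerProb_le_measure {A B : Set Ω} (hBA : B ⊆ A) (hA : MeasurableSet A) :
    outerProb P B ≤ P A :=
  iInf₂_le_of_le A hBA (iInf_le _ hA)

theorem outerProb_mono {A B : Set Ω} (hBA : B ⊆ A) : outerProb P B ≤ outerProb P A :=
  le_iInf₂ fun _ hC => le_iInf fun hCm => outerProb_le_measure (hBA.trans hC) hCm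

/-- Markov's inequality for outer expectations. -/
theorem outerProb_le_outerExpectation [IsFiniteMeasure P] {T : Ω → ℝ} {B : Set Ω} {C : ℝ}
    (h0 : ∀ ω, 0 ≤ T ω) (h1 : ∀ ω ∈ B, 1 ≤ T ω) (hC : ∀ ω, T ω ≤ C) :
    outerProb P B ≤ ENNReal.ofReal (outerExpectation P T) := by
  have htop : outerProb P B ≠ ∞ :=
    ((outerProb_le_measure (subset_univ B) MeasurableSet.univ).trans_lt (measure_lt_top P _)).ne
  refine (ENNReal.le_ofReal_iff_toReal_le htop ?_).2 ?_
  · refine Real.sInf_nonneg ?_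
    rintro r ⟨U, -, -, hTU, rfl⟩
    exact integral_nonneg fun ω => (h0 ω).trans (hTU ω)
  · refine le_csInf ⟨_, fun _ => C, measurable_const, integrable_const C, hC, rfl⟩ ?_
    rintro r ⟨U, hU, hUi, hTU, rfl⟩
    have hmarkov := mul_meas_ge_le_integral_of_nonneg
      (ae_of_all P fun ω => (h0 ω).trans (hTU ω)) hUi 1
    rw [one_mul] at hmarkov
    refine le_trans (ENNReal.toReal_mono (measure_ne_top P _) ?_) hmarkov
    exact outerProb_le_measure (fun ω hω => (h1 ω hω).trans (hTU ω))
      (measurableSet_le measurable_const hU)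

end OuterProbability

/-! ### From pathwise limits to bounds on outer probability. -/

section Portmanteau

variable {Ω D : Type*} [MeasurableSpace Ω] {P : Measure Ω} [IsFiniteMeasure P]

/-- The closed-set half of the portmanteau theorem for Hoffmann-Jorgensen convergence. -/
theorem ConvergesWeakly.limsup_outerProb_preimage_le [PseudoMetricSpace D]
    {X : ℕ → Ω → D} {Y : Ω → D} (h : ConvergesWeakly P X Y) {F : Set D} (hF : IsClosed F) :
    limsup (fun n => outerProb P (X n ⁻¹' F)) atTop ≤ P (Y ⁻¹' F) := by
  let _ : MeasurableSpace D := borel D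
  have _ : BorelSpace D := ⟨rfl⟩
  have hY : Measurable Y := h.borel_measurable
  have happr := HasOuterApproxClosed.tendsto_lintegral_apprSeq hF (P.map Y)
  rw [Measure.map_apply hY hF.measurableSet] at happr
  -- The bounded continuous approximations of the indicator of `F` dominate it, so it suffices to
  -- bound the limsup by the integral of each one.
  refine ge_of_tendsto' happr fun k => ?_
  let f : D →ᵇ ℝ := BoundedContinuousFunction.comp ((↑) : NNReal → ℝ)
    NNReal.isometry_coe.lipschitz (hF.apprSeq k)
  have hf : ∀ x, f x = (hF.apprSeq k x : ℝ) := fun _ => rfl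
  have hlim := ENNReal.tendsto_ofReal (h.tendsto_outerExpectation f)
  have hint : ENNReal.ofReal (∫ ω, f (Y ω) ∂P) = ∫⁻ x, hF.apprSeq k x ∂(P.map Y) := by
    rw [lintegral_map (by fun_prop) hY, ofReal_integral_eq_lintegral_ofReal]
    · simp [hf]
    · exact Integrable.of_bound (f.continuous.measurable.comp hY).aestronglyMeasurable ‖f‖
        (ae_of_all _ fun ω => f.norm_coe_le_norm _)
    · exact ae_of_all _ fun ω => NNReal.coe_nonneg _
  rw [hint] at hlim
  rw [← hlim.limsup_eq]
  refine limsup_le_limsup (Eventually.of_forall fun n => ?_)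
  refine outerProb_le_outerExpectation (C := 1) (fun ω => NNReal.coe_nonneg _) (fun ω hω => ?_)
    fun ω => ?_
  · rw [hf, HasOuterApproxClosed.apprSeq_apply_eq_one hF k hω, NNReal.coe_one]
  · rw [hf]
    exact_mod_cast HasOuterApproxClosed.apprSeq_apply_le_one hF k _

/-- An extended continuous mapping principle: if the sets `E n` are eventually avoided near each
`Y ω`, `ω ∈ A`, then asymptotically `X n ∈ E n` only outside a measurable superset of `A`. -/
theorem ConvergesWeakly.exists_limsup_outerProb_le [PseudoMetricSpace D]
    {X : ℕ → Ω → D} {Y : Ω → D} (h : ConvergesWeakly P X Y) {E : ℕ → Set D} {A : Set Ω}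
    (hA : ∀ ω ∈ A, ∀ᶠ p : ℕ × D in atTop ×ˢ 𝓝 (Y ω), p.2 ∉ E p.1) :
    ∃ T, MeasurableSet T ∧ A ⊆ Tᶜ ∧
      limsup (fun n => outerProb P (X n ⁻¹' E n)) atTop ≤ P T := by
  let _ : MeasurableSpace D := borel D
  have _ : BorelSpace D := ⟨rfl⟩
  have hY : Measurable Y := h.borel_measurable
  -- The hypothesis on `A` puts `Y ω` in some `U N`. Taking interiors makes the complements closed,
  -- and these contain `E n` for all `n ≥ N`; then `N → ∞` by continuity from above.
  let U : ℕ → Set D := fun N => interior {y | ∀ n, N ≤ n → y ∉ E n}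
  have hUmono : Monotone U := fun N N' hN =>
    interior_mono fun y hy n hn => hy n (hN.trans hn)
  have hFclosed : ∀ N, IsClosed (U N)ᶜ := fun N => isOpen_interior.isClosed_compl
  have hmeas : ∀ N, MeasurableSet (Y ⁻¹' (U N)ᶜ) := fun N => hY (hFclosed N).measurableSet
  refine ⟨⋂ N, Y ⁻¹' (U N)ᶜ, MeasurableSet.iInter hmeas, fun ω hω => ?_, ?_⟩
  · obtain ⟨pa, hpa, pb, hpb, hp⟩ := eventually_prod_iff.1 (hA ω hω)
    obtain ⟨N, hN⟩ := eventually_atTop.1 hpa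
    have hU : Y ω ∈ U N := mem_interior_iff_mem_nhds.2
      (hpb.mono fun y hy n hn => hp (hN n hn) hy)
    exact fun hT => mem_iInter.1 hT N hU
  · refine ge_of_tendsto' (tendsto_measure_iInter_atTop (fun N => (hmeas N).nullMeasurableSet)
      (fun N N' hN => preimage_mono (compl_subset_compl.2 (hUmono hN)))
      ⟨0, measure_ne_top P _⟩) fun N => ?_
    refine le_trans (limsup_le_limsup ?_) (h.limsup_outerProb_preimage_le (hFclosed N))
    filter_upwards [eventually_ge_atTop N] with n hn
    exact outerProb_mono fun ω hω hU => interior_subset hU n hn hω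

end Portmanteau

/-- Each point has a neighbourhood served by one event of `F`; finitely many neighbourhoods cover
`S`, and finitely many events can be intersected. -/
theorem eventually_forall_of_compactSpace {α S : Type*} [TopologicalSpace S] [CompactSpace S]
    {F : Filter α} {p : α → S → Prop}
    (h : ∀ s₀, ∀ᶠ z : α × S in F ×ˢ 𝓝 s₀, p z.1 z.2) : ∀ᶠ a in F, ∀ s, p a s := by
  have key : ∀ᶠ a in F, ∀ s ∈ (univ : Set S), p a s := by
    refine isCompact_univ.induction_on (p := fun K : Set S => ∀ᶠ a in F, ∀ s ∈ K, p a s)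
      (by simp) (fun K L hKL hL => hL.mono fun a ha s hs => ha s (hKL hs)) (fun K L hK hL => ?_)
      fun s₀ _ => ?_
    · filter_upwards [hK, hL] with a haK haL s hs
      exact hs.elim (haK s) (haL s)
    · obtain ⟨pa, hpa, pb, hpb, hp⟩ := eventually_prod_iff.1 (h s₀)
      exact ⟨{s | pb s}, mem_nhdsWithin_of_mem_nhds hpb, hpa.mono fun a ha s hs => hp ha hs⟩
  exact key.mono fun a ha s => ha s (mem_univ s)

/-! ### Finite minima and active index sets. -/

section MinOver

variable {m : ℕ} {S : Type*} {g : Fin m → S → ℝ} {σ : Finset (Fin m)} {s : S} {a : ℝ}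

theorem minOver_le {i : Fin m} (hi : i ∈ σ) : minOver g σ s ≤ g i s :=
  ciInf_le (f := fun j : σ => g j s) (Set.finite_range _).bddBelow ⟨i, hi⟩

theorem exists_eq_minOver (hσ : σ.Nonempty) : ∃ i ∈ σ, g i s = minOver g σ s := by
  have : Nonempty σ := hσ.to_subtype
  obtain ⟨i, hi⟩ := exists_eq_ciInf_of_finite (f := fun j : σ => g j s)
  exact ⟨i, i.2, hi⟩

theorem lt_minOver_iff (hσ : σ.Nonempty) : a < minOver g σ s ↔ ∀ i ∈ σ, a < g i s := by
  refine ⟨fun h i hi => h.trans_le (minOver_le hi), fun h => ?_⟩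
  obtain ⟨i, hi, heq⟩ := exists_eq_minOver (g := g) (s := s) hσ
  exact heq ▸ h i hi

theorem minOver_lt_iff (hσ : σ.Nonempty) : minOver g σ s < a ↔ ∃ i ∈ σ, g i s < a := by
  refine ⟨fun h => ?_, fun ⟨i, hi, h⟩ => (minOver_le hi).trans_lt h⟩
  obtain ⟨i, hi, heq⟩ := exists_eq_minOver (g := g) (s := s) hσ
  exact ⟨i, hi, heq ▸ h⟩

theorem mul_minOver {c : ℝ} (hc : 0 ≤ c) :
    c * minOver g σ s = minOver (fun i s => c * g i s) σ s :=
  Real.mul_iInf_of_nonneg hc _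

theorem univ_nonempty_of_one_le (hm : 1 ≤ m) : (Finset.univ : Finset (Fin m)).Nonempty :=
  ⟨⟨0, hm⟩, Finset.mem_univ _⟩

/-- Rules out `σ = ∅`, for which `minOver` takes the meaningless default value `0`. -/
theorem nonempty_of_mem_minRegion (hm : 1 ≤ m) (hs : s ∈ minRegion g σ) : σ.Nonempty := by
  obtain ⟨i, -, hi⟩ := exists_eq_minOver (g := g) (s := s) (univ_nonempty_of_one_le hm)
  exact ⟨i, (hs i).1 hi.symm⟩

theorem exists_mem_minRegion (g : Fin m → S → ℝ) (s : S) : ∃ σ, s ∈ minRegion g σ := by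
  classical
  exact ⟨Finset.univ.filter fun j => minOver g Finset.univ s = g j s, fun j => by simp⟩

end MinOver

theorem tendsto_inv_fst_atTop {D S : Type*} {F : Filter D} {F' : Filter S} {τ : ℕ → ℝ}
    (hτ_pos : ∀ n, 0 < τ n)
    (hτ : Tendsto τ atTop (𝓝 0)) :
    Tendsto (fun z : (ℕ × D) × S => (τ z.1.1)⁻¹) ((atTop ×ˢ F) ×ˢ F') atTop :=
  (tendsto_inv_nhdsGT_zero.comp (tendsto_nhdsWithin_iff.2
    ⟨hτ, Eventually.of_forall hτ_pos⟩)).comp (tendsto_fst.comp tendsto_fst)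

/-! ### Local behaviour of the scaled minimum near a limit path. -/

section ScaledMinimum

variable {S : Type*} [TopologicalSpace S] [CompactSpace S] {m : ℕ}

/-- The function `τ⁻¹ min_i γ̂^i`, expressed through the fluctuation `y = τ⁻¹ (γ̂ - γ)`. -/
noncomputable def scaledMin (τ : ℝ) (γ : Fin m → C(S, ℝ)) (y : Fin m → EllInfty S) : S → ℝ :=
  minOver (fun i s => τ⁻¹ * γ i s + y i s) Finset.univ

theorem scaledMin_fluctuation {τ : ℝ} (hτ : 0 < τ) (γ : Fin m → C(S, ℝ))
    (z : Fin m → EllInfty S) (s : S) :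
    scaledMin τ γ (fun i => τ⁻¹ • (z i - toEllInfty (γ i))) s
      = τ⁻¹ * minOver (fun i s => z i s) Finset.univ s := by
  rw [mul_minOver (inv_nonneg.2 hτ.le), scaledMin]
  congr 1
  ext i s
  change τ⁻¹ * γ i s + τ⁻¹ * (z i s - γ i s) = τ⁻¹ * z i s
  ring

variable {τ : ℕ → ℝ} {γ : Fin m → C(S, ℝ)} {x : Fin m → C(S, ℝ)} {s₀ : S}

/-- The nearby functions may be discontinuous: uniform closeness to `x` and continuity of `x`
suffice. -/
theorem tendsto_eval_ellInfty (x : Fin m → C(S, ℝ)) (s₀ : S) (i : Fin m) :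
    Tendsto (fun z : (ℕ × (Fin m → EllInfty S)) × S => z.1.2 i z.2)
      ((atTop ×ˢ 𝓝 (fun i => toEllInfty (x i))) ×ˢ 𝓝 s₀) (𝓝 (x i s₀)) := by
  have hnorm : Tendsto (fun z : (ℕ × (Fin m → EllInfty S)) × S => ‖z.1.2 i - toEllInfty (x i)‖)
      ((atTop ×ˢ 𝓝 (fun i => toEllInfty (x i))) ×ˢ 𝓝 s₀) (𝓝 0) := by
    have hy : Tendsto (fun z : (ℕ × (Fin m → EllInfty S)) × S => z.1.2)
        ((atTop ×ˢ 𝓝 (fun i => toEllInfty (x i))) ×ˢ 𝓝 s₀) (𝓝 (fun i => toEllInfty (x i))) :=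
      tendsto_snd.comp tendsto_fst
    exact tendsto_iff_norm_sub_tendsto_zero.1 (tendsto_pi_nhds.1 hy i)
  have hdiff : Tendsto
      (fun z : (ℕ × (Fin m → EllInfty S)) × S => (z.1.2 i - toEllInfty (x i)) z.2)
      ((atTop ×ˢ 𝓝 (fun i => toEllInfty (x i))) ×ˢ 𝓝 s₀) (𝓝 0) :=
    squeeze_zero_norm (fun z => lp.norm_apply_le_norm ENNReal.top_ne_zero _ _) hnorm
  have hx : Tendsto (fun z : (ℕ × (Fin m → EllInfty S)) × S => x i z.2)
      ((atTop ×ˢ 𝓝 (fun i => toEllInfty (x i))) ×ˢ 𝓝 s₀) (𝓝 (x i s₀)) :=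
    ((x i).continuous.tendsto s₀).comp tendsto_snd
  have hsum := hdiff.add hx
  rw [zero_add] at hsum
  refine hsum.congr fun z => ?_
  change z.1.2 i z.2 - x i z.2 + x i z.2 = _
  ring

theorem tendsto_scaled_atTop (hτ_pos : ∀ n, 0 < τ n) (hτ : Tendsto τ atTop (𝓝 0)) (i : Fin m)
    (hi : 0 < γ i s₀) :
    Tendsto (fun z : (ℕ × (Fin m → EllInfty S)) × S => (τ z.1.1)⁻¹ * γ i z.2 + z.1.2 i z.2)
      ((atTop ×ˢ 𝓝 (fun i => toEllInfty (x i))) ×ˢ 𝓝 s₀) atTop :=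
  Tendsto.atTop_add ((tendsto_inv_fst_atTop hτ_pos hτ).atTop_mul_pos hi
    (((γ i).continuous.tendsto s₀).comp tendsto_snd)) (tendsto_eval_ellInfty x s₀ i)

theorem tendsto_scaled_atBot (hτ_pos : ∀ n, 0 < τ n) (hτ : Tendsto τ atTop (𝓝 0)) (i : Fin m)
    (hi : γ i s₀ < 0) :
    Tendsto (fun z : (ℕ × (Fin m → EllInfty S)) × S => (τ z.1.1)⁻¹ * γ i z.2 + z.1.2 i z.2)
      ((atTop ×ˢ 𝓝 (fun i => toEllInfty (x i))) ×ˢ 𝓝 s₀) atBot :=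
  Tendsto.atBot_add ((tendsto_inv_fst_atTop hτ_pos hτ).atTop_mul_neg hi
    (((γ i).continuous.tendsto s₀).comp tendsto_snd)) (tendsto_eval_ellInfty x s₀ i)

/-- Points of `{μ = 0}` where `|G^σ|` exceeds `q` eventually violate the inclusions. -/
theorem eventually_lt_abs_scaledMin (hm : 1 ≤ m) (hτ_pos : ∀ n, 0 < τ n)
    (hτ : Tendsto τ atTop (𝓝 0)) {σ : Finset (Fin m)} {q : ℝ}
    (hμ : minOver (fun i s => γ i s) Finset.univ s₀ = 0)
    (hV : s₀ ∈ minRegion (fun i s => γ i s) σ)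
    (hq : q < |minOver (fun i s => x i s) σ s₀|) :
    ∀ᶠ p : ℕ × (Fin m → EllInfty S) in atTop ×ˢ 𝓝 (fun i => toEllInfty (x i)),
      scaledMin (τ p.1) γ p.2 s₀ < -q ∨ q < scaledMin (τ p.1) γ p.2 s₀ := by
  have hσ := nonempty_of_mem_minRegion hm hV
  have hun := univ_nonempty_of_one_le hm
  have hzero : ∀ i ∈ σ, γ i s₀ = 0 := fun i hi => ((hV i).2 hi).symm.trans hμ
  -- The point is fixed here; letting it vary and then setting `z.2 = s₀` allows the joint limits in
  -- `(n, y, s)` to be reused.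
  suffices hev : ∀ᶠ z : (ℕ × (Fin m → EllInfty S)) × S in
      (atTop ×ˢ 𝓝 (fun i => toEllInfty (x i))) ×ˢ 𝓝 s₀, z.2 = s₀ →
      scaledMin (τ z.1.1) γ z.1.2 s₀ < -q ∨ q < scaledMin (τ z.1.1) γ z.1.2 s₀ by
    refine hev.curry.mono fun p hp => hp.self_of_nhds rfl
  rcases lt_abs.1 hq with hq | hq
  · have hall : ∀ i, ∀ᶠ z : (ℕ × (Fin m → EllInfty S)) × S in
        (atTop ×ˢ 𝓝 (fun i => toEllInfty (x i))) ×ˢ 𝓝 s₀, z.2 = s₀ →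
        q < (τ z.1.1)⁻¹ * γ i s₀ + z.1.2 i s₀ := by
      intro i
      by_cases hi : i ∈ σ
      · filter_upwards [(tendsto_eval_ellInfty x s₀ i).eventually_const_lt
          ((lt_minOver_iff hσ).1 hq i hi)] with z hz hzs
        simpa [hzero i hi, hzs] using hz
      · have hpos : 0 < γ i s₀ :=
          lt_of_le_of_ne (hμ ▸ minOver_le (g := fun i s => γ i s) (Finset.mem_univ i))
            fun h => hi ((hV i).1 (hμ.trans h))
        filter_upwards [(tendsto_scaled_atTop (x := x) hτ_pos hτ i hpos).eventually_gt_atTop q]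
          with z hz hzs
        simpa [hzs] using hz
    filter_upwards [eventually_all.2 hall] with z hz hzs
    exact Or.inr ((lt_minOver_iff hun).2 fun i _ => hz i hzs)
  · obtain ⟨i, hi, hlt⟩ := (minOver_lt_iff hσ).1 (lt_neg_of_lt_neg hq)
    filter_upwards [(tendsto_eval_ellInfty x s₀ i).eventually_lt_const hlt] with z hz hzs
    refine Or.inl ((minOver_lt_iff hun).2 ⟨i, Finset.mem_univ i, ?_⟩)
    simpa [hzero i hi, hzs] using hz

/-- If `-G^σ < q` on `𝔲⁺` and `G^σ < q` on `𝔲⁻`, the inclusions eventually hold near `x`. -/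
theorem eventually_forall_scaledMin_bounds (hm : 1 ≤ m) (hτ_pos : ∀ n, 0 < τ n)
    (hτ : Tendsto τ atTop (𝓝 0)) {q : ℝ}
    (hplus : ∀ σ, ∀ s ∈ uPlus (minOver (fun i s => γ i s) Finset.univ)
      (minRegion (fun i s => γ i s) σ), -minOver (fun i s => x i s) σ s < q)
    (hminus : ∀ σ, ∀ s ∈ uMinus (minOver (fun i s => γ i s) Finset.univ)
      (minRegion (fun i s => γ i s) σ), minOver (fun i s => x i s) σ s < q) :
    ∀ᶠ p : ℕ × (Fin m → EllInfty S) in atTop ×ˢ 𝓝 (fun i => toEllInfty (x i)), ∀ s,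
      (0 ≤ minOver (fun i s => γ i s) Finset.univ s → -q < scaledMin (τ p.1) γ p.2 s) ∧
      (minOver (fun i s => γ i s) Finset.univ s ≤ 0 → scaledMin (τ p.1) γ p.2 s < q) := by
  set μ : S → ℝ := minOver (fun i s => γ i s) Finset.univ
  have hun := univ_nonempty_of_one_le hm
  have hμle : ∀ i s, μ s ≤ γ i s := fun i s => minOver_le (Finset.mem_univ i)
  refine eventually_forall_of_compactSpace fun s₀ => ?_
  have hγ : ∀ i, Tendsto (fun z : (ℕ × (Fin m → EllInfty S)) × S => γ i z.2)
      ((atTop ×ˢ 𝓝 (fun i => toEllInfty (x i))) ×ˢ 𝓝 s₀) (𝓝 (γ i s₀)) := fun i =>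
    ((γ i).continuous.tendsto s₀).comp tendsto_snd
  have hlt : ∀ c, μ s₀ < c → ∀ᶠ z : (ℕ × (Fin m → EllInfty S)) × S in
      (atTop ×ˢ 𝓝 (fun i => toEllInfty (x i))) ×ˢ 𝓝 s₀, μ z.2 < c := by
    intro c hc
    obtain ⟨i, -, hi⟩ := (minOver_lt_iff hun).1 hc
    exact ((hγ i).eventually_lt_const hi).mono fun z hz => (hμle i _).trans_lt hz
  have hgt : ∀ c, c < μ s₀ → ∀ᶠ z : (ℕ × (Fin m → EllInfty S)) × S in
      (atTop ×ˢ 𝓝 (fun i => toEllInfty (x i))) ×ˢ 𝓝 s₀, c < μ z.2 := by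
    intro c hc
    have hall : ∀ i, ∀ᶠ z : (ℕ × (Fin m → EllInfty S)) × S in
        (atTop ×ˢ 𝓝 (fun i => toEllInfty (x i))) ×ˢ 𝓝 s₀, c < γ i z.2 := fun i =>
      (hγ i).eventually_const_lt (hc.trans_le (hμle i s₀))
    exact (eventually_all.2 hall).mono fun z hz => (lt_minOver_iff hun).2 fun i _ => hz i
  refine Eventually.and ?_ ?_
  · rcases lt_or_ge (μ s₀) 0 with hneg | hnonneg
    · exact (hlt 0 hneg).mono fun z hz h0 => absurd hz h0.not_gt
    -- A lower bound on the minimum is needed for every index. An index vanishing at `s₀` is active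
    -- there, so the active set of `s₀` itself suffices.
    have hall : ∀ i, ∀ᶠ z : (ℕ × (Fin m → EllInfty S)) × S in
        (atTop ×ˢ 𝓝 (fun i => toEllInfty (x i))) ×ˢ 𝓝 s₀, 0 ≤ μ z.2 →
        -q < (τ z.1.1)⁻¹ * γ i z.2 + z.1.2 i z.2 := by
      intro i
      rcases (hnonneg.trans (hμle i s₀)).lt_or_eq with hpos | hzero
      · exact ((tendsto_scaled_atTop hτ_pos hτ i hpos).eventually_gt_atTop (-q)).mono
          fun z hz _ => hz
      have hμ0 : μ s₀ = 0 := le_antisymm (hzero ▸ hμle i s₀) hnonneg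
      obtain ⟨σ, hσ⟩ := exists_mem_minRegion (fun i s => γ i s) s₀
      have hiσ : i ∈ σ := (hσ i).1 (hμ0.trans hzero)
      have hmem : s₀ ∈ uPlus μ (minRegion (fun i s => γ i s) σ) :=
        mem_iInter₂.2 fun η hη => by
          have hIcc : s₀ ∈ μ ⁻¹' Icc 0 η := ⟨hμ0.ge, hμ0.trans_le hη.le⟩
          exact subset_closure ⟨subset_closure hIcc, hσ⟩
      have hxi : -q < x i s₀ :=
        (neg_lt.1 (hplus σ s₀ hmem)).trans_le (minOver_le (g := fun i s => x i s) hiσ)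
      filter_upwards [(tendsto_eval_ellInfty x s₀ i).eventually_const_lt hxi] with z hz h0
      exact lt_add_of_nonneg_of_lt
        (mul_nonneg (inv_nonneg.2 (hτ_pos _).le) (h0.trans (hμle i _))) hz
    exact (eventually_all.2 hall).mono fun z hz h0 => (lt_minOver_iff hun).2 fun i _ => hz i h0
  · rcases lt_trichotomy (μ s₀) 0 with hneg | hzero | hpos
    · obtain ⟨i, -, hi⟩ := (minOver_lt_iff hun).1 hneg
      exact ((tendsto_scaled_atBot hτ_pos hτ i hi).eventually_lt_atBot q).mono
        fun z hz _ => (minOver_lt_iff hun).2 ⟨i, Finset.mem_univ i, hz⟩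
    -- An upper bound needs one index, but it must have `γⁱ(s) ≤ 0` at the nearby point `s`, so it
    -- is taken from the active set `σ` of `s` rather than of `s₀`. If `s₀` is not in `uMinus` for
    -- this `σ`, no such `s` occurs near `s₀`. There are finitely many `σ`.
    · have hall : ∀ σ, ∀ᶠ z : (ℕ × (Fin m → EllInfty S)) × S in
          (atTop ×ˢ 𝓝 (fun i => toEllInfty (x i))) ×ˢ 𝓝 s₀,
          z.2 ∈ minRegion (fun i s => γ i s) σ → μ z.2 ≤ 0 →
            scaledMin (τ z.1.1) γ z.1.2 z.2 < q := by
        intro σ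
        rcases σ.eq_empty_or_nonempty with rfl | hσ
        · exact Eventually.of_forall fun z hz =>
            absurd (nonempty_of_mem_minRegion hm hz) Finset.not_nonempty_empty
        by_cases hmem : s₀ ∈ uMinus μ (minRegion (fun i s => γ i s) σ)
        · obtain ⟨i, hi, hxi⟩ := (minOver_lt_iff hσ).1 (hminus σ s₀ hmem)
          filter_upwards [(tendsto_eval_ellInfty x s₀ i).eventually_lt_const hxi] with z hz hV h0
          refine (minOver_lt_iff hun).2 ⟨i, Finset.mem_univ i, ?_⟩
          have hγi : γ i z.2 ≤ 0 := ((hV i).2 hi).symm.trans_le h0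
          exact add_lt_of_nonpos_of_lt
            (mul_nonpos_of_nonneg_of_nonpos (inv_nonneg.2 (hτ_pos _).le) hγi) hz
        · obtain ⟨η, hη, hnot⟩ : ∃ η : ℝ, 0 < η ∧
              s₀ ∉ closure (closure (μ ⁻¹' Icc (-η) 0) ∩ minRegion (fun i s => γ i s) σ) := by
            simpa [uMinus] using hmem
          have hopen : ∀ᶠ z : (ℕ × (Fin m → EllInfty S)) × S in
              (atTop ×ˢ 𝓝 (fun i => toEllInfty (x i))) ×ˢ 𝓝 s₀,
              z.2 ∉ closure (closure (μ ⁻¹' Icc (-η) 0) ∩ minRegion (fun i s => γ i s) σ) :=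
            tendsto_snd.eventually (isClosed_closure.isOpen_compl.mem_nhds hnot)
          filter_upwards [hopen, hgt (-η) (by rw [hzero]; exact neg_lt_zero.2 hη)]
            with z hz hη' hV h0
          have hIcc : z.2 ∈ μ ⁻¹' Icc (-η) 0 := ⟨hη'.le, h0⟩
          exact (hz (subset_closure ⟨subset_closure hIcc, hV⟩)).elim
      filter_upwards [eventually_all.2 hall] with z hz
      obtain ⟨σ, hσ⟩ := exists_mem_minRegion (fun i s => γ i s) z.2
      exact hz σ hσ
    · exact (hgt 0 hpos).mono fun z hz h0 => absurd hz h0.not_gt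

end ScaledMinimum

/-- The inclusion event as a property of the fluctuation `y = τ⁻¹ (γ̂ - γ)`. -/
def fluctuationInclusion {S : Type*} [TopologicalSpace S] [CompactSpace S] {m : ℕ} (τ q : ℝ)
    (γ : Fin m → C(S, ℝ)) : Set (Fin m → EllInfty S) :=
  {y | {s | scaledMin τ γ y s < -q} ⊆ {s | minOver (fun i s => γ i s) Finset.univ s < 0} ∧
    {s | scaledMin τ γ y s > q} ⊆ {s | minOver (fun i s => γ i s) Finset.univ s > 0}}

end ConjunctionCR

/-! ### The two probability bounds. -/

theorem mainTheorem9
    {S : Type*} [MetricSpace S] [CompactSpace S]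
    {Ω : Type*} [MeasurableSpace Ω] (P : Measure Ω) [IsProbabilityMeasure P]
    (m : ℕ) (hm : 1 ≤ m)
    (τ : ℕ → ℝ) (hτ_pos : ∀ n, 0 < τ n) (hτ : Tendsto τ atTop (𝓝 0))
    (γ : Fin m → C(S, ℝ))
    (γhat : ℕ → Ω → Fin m → EllInfty S)
    (J : Ω → Fin m → C(S, ℝ))
    (hCLT : ConvergesWeakly P
      (fun n ω i => (τ n)⁻¹ • (γhat n ω i - toEllInfty (γ i)))
      (fun ω i => toEllInfty (J ω i)))
    (q : ℝ) :
    let μ : S → ℝ := minOver (fun i s => γ i s) Finset.univ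
    let μhat : ℕ → Ω → S → ℝ := fun n ω => minOver (fun i s => γhat n ω i s) Finset.univ
    let V : Finset (Fin m) → Set S := minRegion (fun i s => γ i s)
    let G : Finset (Fin m) → Ω → S → ℝ := fun σ ω => minOver (fun i s => J ω i s) σ
    P {ω | (⨆ σ : Finset (Fin m),
          max (⨆ s ∈ uPlus μ (V σ), ((-G σ ω s : ℝ) : EReal))
            (⨆ s ∈ uMinus μ (V σ), ((G σ ω s : ℝ) : EReal))) < (q : EReal)}
        ≤ liminf (fun n => innerProb P (inclusionEvent (τ n) q (μhat n) μ)) atTop ∧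
      limsup (fun n => outerProb P (inclusionEvent (τ n) q (μhat n) μ)) atTop
        ≤ P {ω | (⨆ σ : Finset (Fin m),
          ⨆ s ∈ μ ⁻¹' {0} ∩ V σ, ((|G σ ω s| : ℝ) : EReal)) ≤ (q : EReal)} := by

  intro μ μhat V G
  set X : ℕ → Ω → Fin m → EllInfty S :=
    fun n ω i => (τ n)⁻¹ • (γhat n ω i - toEllInfty (γ i)) with hX
  have hevent : ∀ n, inclusionEvent (τ n) q (μhat n) μ
      = X n ⁻¹' fluctuationInclusion (τ n) q γ := by
    intro n
    ext ω
    simp only [inclusionEvent, fluctuationInclusion, hX, mem_preimage, mem_ofPred_eq,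
      scaledMin_fluctuation (hτ_pos n), μhat, μ]
  simp only [hevent]
  constructor
  · obtain ⟨T, hT, hsub, hle⟩ := hCLT.exists_limsup_outerProb_le
      (E := fun n => (fluctuationInclusion (τ n) q γ)ᶜ)
      (A := {ω | (⨆ σ : Finset (Fin m),
          max (⨆ s ∈ uPlus μ (V σ), ((-G σ ω s : ℝ) : EReal))
            (⨆ s ∈ uMinus μ (V σ), ((G σ ω s : ℝ) : EReal))) < (q : EReal)}) (by
        intro ω hω
        refine (eventually_forall_scaledMin_bounds (x := J ω) (γ := γ) hm hτ_pos hτ (q := q) ?_ ?_).mono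
          fun p hp => not_not_intro ⟨fun s hs => ?_, fun s hs => ?_⟩
        · intro σ s hs
          refine EReal.coe_lt_coe_iff.1 (lt_of_le_of_lt ?_ hω)
          exact (le_iSup₂_of_le (f := fun s (_ : s ∈ uPlus μ (V σ)) => ((-G σ ω s : ℝ) : EReal))
            s hs le_rfl).trans ((le_max_left _ _).trans (le_iSup (fun σ : Finset (Fin m) =>
              max (⨆ s ∈ uPlus μ (V σ), ((-G σ ω s : ℝ) : EReal))
                (⨆ s ∈ uMinus μ (V σ), ((G σ ω s : ℝ) : EReal))) σ))
        · intro σ s hs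
          refine EReal.coe_lt_coe_iff.1 (lt_of_le_of_lt ?_ hω)
          exact (le_iSup₂_of_le (f := fun s (_ : s ∈ uMinus μ (V σ)) => ((G σ ω s : ℝ) : EReal))
            s hs le_rfl).trans ((le_max_right _ _).trans (le_iSup (fun σ : Finset (Fin m) =>
              max (⨆ s ∈ uPlus μ (V σ), ((-G σ ω s : ℝ) : EReal))
                (⨆ s ∈ uMinus μ (V σ), ((G σ ω s : ℝ) : EReal))) σ))
        · exact not_le.1 fun h => lt_asymm hs ((hp s).1 h)
        · exact not_le.1 fun h => lt_asymm hs ((hp s).2 h))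
    -- The event on the left is not known to be measurable, so complements are taken only of the
    -- measurable set `T`.
    refine (measure_mono hsub).trans ?_
    rw [prob_compl_eq_one_sub hT]
    simp only [innerProb]
    rw [ENNReal.liminf_const_sub _ _ ENNReal.one_ne_top]
    exact tsub_le_tsub_left hle 1
  · obtain ⟨T, hT, hsub, hle⟩ := hCLT.exists_limsup_outerProb_le
      (E := fun n => fluctuationInclusion (τ n) q γ)
      (A := {ω | (⨆ σ : Finset (Fin m),
          ⨆ s ∈ μ ⁻¹' {0} ∩ V σ, ((|G σ ω s| : ℝ) : EReal)) ≤ (q : EReal)}ᶜ) (by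
        intro ω hω
        obtain ⟨σ, s, hs, hlt⟩ : ∃ σ, ∃ s ∈ μ ⁻¹' {0} ∩ V σ, q < |G σ ω s| := by
          by_contra! hcon
          exact hω (iSup_le fun σ => iSup₂_le fun s hs => EReal.coe_le_coe_iff.2 (hcon σ s hs))
        refine (eventually_lt_abs_scaledMin (x := J ω) hm hτ_pos hτ hs.1 hs.2 hlt).mono
          fun p hp hmem => hp.elim (fun h => ?_) fun h => ?_
        · exact (hmem.1 h).ne hs.1
        · exact (hmem.2 h).ne' hs.1)
    exact hle.trans (measure_mono fun ω hω => not_not.1 fun h => hsub h hω)
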